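/- Let $N\ge 0$ be an integer. For a potential $W:\mathbb C\to[-\infty,+\infty]$ (a measurable function, with $e^{-\infty}=0$) the complex ensemble with potential $W$ is the probability law on $\mathbb C^N$ with density $$\frac{1}{N!\,Z_N^{\mathbb C}(W)}\prod_{j=1}^N e^{-W(z_j)}\prod_{1\le j<k\le N}|z_k-z_j|^2 ,$$ and the symplectic ensemble with potential $W$ is the probability law on $\{(z_1,\dots,z_N)\in\mathbb C^N:\operatorname{Im} z_j>0 \text{ for all } j\}$ with density $$\frac{1}{N!\,Z_N^{\mathbb H}(W)}\prod_{j=1}^N e^{-2W(z_j)}|z_j-\bar z_j|^2\prod_{1\le j<k\le N}|z_k-z_j|^2|z_k-\bar z_j|^2 ,$$ where the partition functions $Z_N^{\mathbb C}(W)$ and $Z_N^{\mathbb H}(W)$ are the normalising constants, whenever these are positive and finite. Write $E_N^{\mathbb C}(W;D)$ and $E_N^{\mathbb H}(W;D)$ for the probability that no particle of the respective ensemble lies in $D\subset\mathbb C$. Let $D\subset\mathbb C$ be a measurable radially symmetric set (membership of $z$ in $D$ depends on $|z|$ only; for instance, a radially symmetric domain), and let $\tilde D=\{z^2: z\in D\}$.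 (i) Let $W_{\mathbb C}(z)=\omega_{\mathbb C}(|z|)$ be a radially symmetric potential with $0<Z_N^{\mathbb C}(W_{\mathbb C})<\infty$, and let $W_{\mathbb H}(z)=\tfrac12\,\omega_{\mathbb C}(|z|^2)$. Then the symplectic ensemble with potential $W_{\mathbb H}$ is also well defined, and $$E_N^{\mathbb H}(W_{\mathbb H};D)=E_N^{\mathbb C}(W_{\mathbb C};\tilde D).$$ (ii) For $b>0$ and $\alpha>-1$ let $W^{\rm ML}_{\alpha,b}(z)=|z|^{2b}-2\alpha\log|z|$ be the Mittag-Leffler potential. Then the symplectic ensemble with potential $W^{\rm ML}_{\alpha,b}$ and the complex ensemble with potential $W^{\rm ML}_{\alpha,b/2}$ are well defined, and $$E_N^{\mathbb H}(W^{\rm ML}_{\alpha,b};D)=E_N^{\mathbb C}\big(W^{\rm ML}_{\alpha,b/2};\,2^{1/b}\tilde D\big).$$ (iii) In particular, for the eigenvalues of the symplectic Ginibre ensemble (GinSE), that is, the symplectic ensemble with potential $W(z)=|z|^2$, the gap probability is $E_N^{\mathbb H}(|z|^2;D)=E_N^{\mathbb C}\big(W^{\rm ML}_{0,1/2};2\tilde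 D\big)$, where $W^{\rm ML}_{0,1/2}(z)=|z|$; both ensembles are well defined. -/

import Mathlib

open MeasureTheory
open scoped ENNReal

noncomputable section

namespace PlanarEnsembles

/-- The potential `z ↦ ω(|z|)`; potentials take values in the extended reals, so that hard walls
(`ω = +∞`) and logarithmic poles at the origin are allowed. -/
def radialPotential (ω : ℝ → EReal) : ℂ → EReal := fun z => ω ‖z‖

/-- The unnormalised density of the complex (normal matrix) ensemble,
`∏_j e^{-W(z_j)} ∏_{j<k} |z_k - z_j|²`, i.e. `e^{-H_ℂ}`. -/
def complexWeight (N : ℕ) (W : ℂ → EReal) (z : Fin N → ℂ) : ℝ≥0∞ :=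
  (∏ j, EReal.exp (-(W (z j)))) *
    ∏ j, ∏ k ∈ Finset.Ioi j, ENNReal.ofReal (‖z k - z j‖ ^ 2)

/-- The unnormalised density of the planar symplectic ensemble,
`∏_j e^{-2W(z_j)} |z_j - conj z_j|² ∏_{j<k} |z_k - z_j|² |z_k - conj z_j|²`, i.e. `e^{-H_ℍ}`. -/
def symplecticWeight (N : ℕ) (W : ℂ → EReal) (z : Fin N → ℂ) : ℝ≥0∞ :=
  (∏ j, EReal.exp (-(2 * W (z j))) * ENNReal.ofReal (‖z j - starRingEnd ℂ (z j)‖ ^ 2)) *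
    ∏ j, ∏ k ∈ Finset.Ioi j,
      ENNReal.ofReal (‖z k - z j‖ ^ 2 * ‖z k - starRingEnd ℂ (z j)‖ ^ 2)

/-- Configurations with all particles in the open upper half-plane. -/
def upperConfigurations (N : ℕ) : Set (Fin N → ℂ) := {z | ∀ j, 0 < (z j).im}

/-- The partition function `Z_N^ℂ(W)`. -/
def complexPartition (N : ℕ) (W : ℂ → EReal) : ℝ≥0∞ :=
  (∫⁻ z : Fin N → ℂ, complexWeight N W z) / (N.factorial : ℝ≥0∞)

/-- The partition function `Z_N^ℍ(W)` of the ensemble on the upper half-plane. -/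
def symplecticPartition (N : ℕ) (W : ℂ → EReal) : ℝ≥0∞ :=
  (∫⁻ z in upperConfigurations N, symplecticWeight N W z) / (N.factorial : ℝ≥0∞)

/-- The complex ensemble: the law with density `e^{-H_ℂ} / (N! Z_N^ℂ(W))` on `ℂ^N`. -/
def complexEnsemble (N : ℕ) (W : ℂ → EReal) : Measure (Fin N → ℂ) :=
  volume.withDensity fun z =>
    complexWeight N W z / ((N.factorial : ℝ≥0∞) * complexPartition N W)

/-- The planar symplectic ensemble: the law with density `e^{-H_ℍ} / (N! Z_N^ℍ(W))` on
configurations in the upper half-plane. -/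
def symplecticEnsemble (N : ℕ) (W : ℂ → EReal) : Measure (Fin N → ℂ) :=
  (volume.restrict (upperConfigurations N)).withDensity fun z =>
    symplecticWeight N W z / ((N.factorial : ℝ≥0∞) * symplecticPartition N W)

/-- The gap probability: under the law `μ` no particle lies in `D`. -/
def gapProbability {N : ℕ} (μ : Measure (Fin N → ℂ)) (D : Set ℂ) : ℝ≥0∞ :=
  μ {z | ∀ j, z j ∉ D}

/-- A set of complex numbers that depends on the modulus only. -/
def IsRadiallySymmetric (D : Set ℂ) : Prop :=
  ∀ z w : ℂ, ‖z‖ = ‖w‖ → z ∈ D → w ∈ D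

/-- `ω_ℍ(r) = ω_ℂ(r²) / 2`. -/
def symplecticProfile (ωC : ℝ → EReal) : ℝ → EReal :=
  fun r => ((1 / 2 : ℝ) : EReal) * ωC (r ^ 2)

/-- The Mittag-Leffler profile `r^{2b} - 2 α log r`; its value at the single point `r = 0` is
irrelevant to the ensembles. -/
def mittagLefflerProfile (α b : ℝ) : ℝ → EReal :=
  fun r => ((r ^ (2 * b) - 2 * α * Real.log r : ℝ) : EReal)

/-- The profile `r²` of the Ginibre ensembles. -/
def ginibreProfile : ℝ → EReal := fun r => ((r ^ 2 : ℝ) : EReal)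

end PlanarEnsembles

end

/-!
The integral over the angles turns both partition integrals into products of one-particle moments.
For a radial weight `f`, write `m_p = ∫ f(|z|) |z|^p d²z` (`radialMoment`). The Lebesgue measure on
`ℂ^N` is invariant under independent rotations of the particles, so the interaction factor may be
replaced by its average over the torus (`lintegral_radial_mul_eq_average`); this is an identity of
lower integrals, valid for every measurable weight.

* In the complex ensemble `|Δ(z)|²` is a double sum over permutations, of which only the diagonal
  terms survive the average. Hence `∫ ∏ f(|z_j|) |Δ(z)|² = N! ∏_{k<N} m_{2k}`
  (`lintegral_complexInteraction`).
* In the symplectic ensemble the interaction is `∏_j (z_j - conj z_j)` times the Vandermonde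
  determinant with the `2N` nodes `z_1, conj z_1, …, z_N, conj z_N`. In its Leibniz expansion the
  average kills every permutation that does not send each pair of nodes to neighbouring exponents;
  the remaining ones permute the pairs `(2k, 2k+1)` as blocks, and all of them contribute
  positively (`sum_sign_mul_prod_pairMoment`). Since the interaction is invariant under
  conjugation of single particles, the half-planes can be traded for planes, and the integral is
  `N! ∏_{k<N} m_{4k+2}` (`setLIntegral_symplecticInteraction`).

Requiring that no particle lies in a radially symmetric set `D` only replaces `f` by a weight that
vanishes on `D`, so gap probabilities are ratios of such products. If `f_ℍ(r) = K f_ℂ(c r²)`, the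
substitution `u = c r²` shows that `m_{4k+2}(f_ℍ)` is a constant multiple of `m_{2k}(f_ℂ)`
(`radialMoment_of_comp_mul_sq`), with a constant that does not see the gap and cancels in the ratio
(`symplectic_complex_of_matched`). The general statement is the case `c = 1`; for the Mittag-Leffler
potentials `c = 2^{1/b}`, and the moments are values of the Gamma function.
-/

namespace PlanarEnsembles

open AddCircle ComplexConjugate

/-! ### Averages over the torus -/

/-- Tonelli's theorem for a product of functions of one coordinate each. -/
theorem lintegral_fin_prod_eq_prod {E : Type*} [MeasurableSpace E] (μ : Measure E) [SigmaFinite μ]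
    {n : ℕ} (f : Fin n → E → ℝ≥0∞) (hf : ∀ i, Measurable (f i)) :
    ∫⁻ x : Fin n → E, ∏ i, f i (x i) ∂(Measure.pi fun _ => μ) = ∏ i, ∫⁻ x, f i x ∂μ := by
  induction n with
  | zero => simp
  | succ n ih =>
    calc
      _ = ∫⁻ x : E × (Fin n → E), f 0 x.1 * ∏ i : Fin n, f (Fin.succ i) (x.2 i)
            ∂(μ.prod (Measure.pi fun _ => μ)) := by
        rw [← ((measurePreserving_piFinSuccAbove (fun _ => μ) 0).symm).lintegral_comp_emb
          (MeasurableEquiv.measurableEmbedding _)]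
        simp_rw [MeasurableEquiv.piFinSuccAbove_symm_apply, Fin.insertNthEquiv,
          Fin.prod_univ_succ, Fin.insertNth_zero, Equiv.coe_fn_mk, Fin.cons_succ, Fin.cons_zero]
        rfl
      _ = (∫⁻ x, f 0 x ∂μ) * ∏ i : Fin n, ∫⁻ x, f (Fin.succ i) x ∂μ := by
        rw [← ih _ fun i => hf i.succ, ← lintegral_prod_mul (hf 0).aemeasurable]
        exact (Finset.measurable_prod _ fun i _ =>
          (hf i.succ).comp (measurable_pi_apply i)).aemeasurable
      _ = _ := by rw [Fin.prod_univ_succ]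

/-- The configuration `z` with its `j`-th particle rotated by the angle `x j`. -/
noncomputable def rotate {N : ℕ} (x : Fin N → UnitAddCircle) (z : Fin N → ℂ) : Fin N → ℂ :=
  fun j => (toCircle (x j) : ℂ) * z j

/-- The uniform law on the torus of `N` independent angles. -/
noncomputable def angleMeasure (N : ℕ) : Measure (Fin N → UnitAddCircle) :=
  Measure.pi fun _ => haarAddCircle

instance (N : ℕ) : IsProbabilityMeasure (angleMeasure N) := by
  unfold angleMeasure; infer_instance

theorem continuous_toCircle_coe : Continuous fun x : UnitAddCircle => (toCircle x : ℂ) :=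
  continuous_subtype_val.comp continuous_toCircle

theorem continuous_rotate {N : ℕ} :
    Continuous fun p : (Fin N → UnitAddCircle) × (Fin N → ℂ) => rotate p.1 p.2 := by
  refine continuous_pi fun j => ?_
  exact (continuous_toCircle_coe.comp ((continuous_apply j).comp continuous_fst)).mul
    ((continuous_apply j).comp continuous_snd)

theorem norm_rotate {N : ℕ} (x : Fin N → UnitAddCircle) (z : Fin N → ℂ) (j : Fin N) :
    ‖rotate x z j‖ = ‖z j‖ := by
  rw [rotate, norm_mul, Circle.norm_coe, one_mul]

theorem measurePreserving_rotate {N : ℕ} (x : Fin N → UnitAddCircle) :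
    MeasurePreserving (rotate x) := by
  refine volume_preserving_pi (f := fun j w => (toCircle (x j) : ℂ) * w) fun j => ?_
  exact (rotation (toCircle (x j))).measurePreserving

theorem integral_fourier (n : ℤ) :
    ∫ x : UnitAddCircle, fourier n x ∂haarAddCircle = if n = 0 then 1 else 0 := by
  have h := congrFun (fourierCoeff_fourier (T := (1 : ℝ)) n) 0
  simp only [fourierCoeff, neg_zero, fourier_zero, one_smul] at h
  rw [h, Pi.single_apply]
  simp [eq_comm]

/-- Only the rotation-invariant monomials survive the average over the angle. -/
theorem integral_rotate_monomial (z : ℂ) (p q : ℕ) :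
    ∫ x : UnitAddCircle, ((toCircle x : ℂ) * z) ^ p * conj ((toCircle x : ℂ) * z) ^ q
      ∂haarAddCircle = if p = q then ((‖z‖ ^ (2 * p) : ℝ) : ℂ) else 0 := by
  have key : ∀ x : UnitAddCircle, ((toCircle x : ℂ) * z) ^ p * conj ((toCircle x : ℂ) * z) ^ q =
      fourier ((p : ℤ) - q) x * (z ^ p * conj z ^ q) := by
    intro x
    rw [sub_eq_add_neg, fourier_add, fourier_neg, fourier_apply, fourier_apply, map_mul,
      toCircle_zsmul, toCircle_zsmul]
    simp only [zpow_natCast, Circle.coe_pow, map_pow]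
    ring
  simp_rw [key]
  rw [integral_mul_const, integral_fourier]
  by_cases h : p = q
  · subst h
    simp only [sub_self, if_true, one_mul]
    rw [← mul_pow, Complex.mul_conj, Complex.normSq_eq_norm_sq, pow_mul]
    push_cast
    rfl
  · rw [if_neg (by omega), if_neg h, zero_mul]

/-- The average over the torus of a sum of products of one-particle functions. -/
theorem integral_rotate_sum_prod {N : ℕ} {ι : Type*} (s : Finset ι) (c : ι → ℂ)
    (φ : ι → Fin N → ℂ → ℂ) (hφ : ∀ i j, Continuous (φ i j)) (z : Fin N → ℂ) :
    ∫ x, ∑ i ∈ s, c i * ∏ j, φ i j (rotate x z j) ∂angleMeasure N =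
      ∑ i ∈ s, c i * ∏ j, ∫ x : UnitAddCircle, φ i j ((toCircle x : ℂ) * z j) ∂haarAddCircle := by
  have hc : ∀ i j, Continuous fun x : UnitAddCircle => φ i j ((toCircle x : ℂ) * z j) :=
    fun i j => (hφ i j).comp (continuous_toCircle_coe.mul continuous_const)
  rw [integral_finsetSum]
  · refine Finset.sum_congr rfl fun i _ => ?_
    rw [integral_const_mul]
    congr 1
    exact integral_fintype_prod_eq_prod
      (fun j x => φ i j ((toCircle x : ℂ) * z j))
  · intro i _
    refine Continuous.integrable_of_hasCompactSupport ?_ (HasCompactSupport.of_compactSpace _)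
    exact continuous_const.mul (continuous_finsetProd _ fun j _ =>
      (hc i j).comp (continuous_apply j))

/-- In an integral against a radial weight the remaining factor may be replaced by its average
over the torus. Working with the lower integral, this needs no integrability of the weight. -/
theorem lintegral_radial_mul_eq_average {N : ℕ} (f : ℝ → ℝ≥0∞) (hf : Measurable f)
    (G A : (Fin N → ℂ) → ℝ) (hG : Continuous G) (hG0 : ∀ z, 0 ≤ G z)
    (hA : ∀ z, ∫ x, G (rotate x z) ∂angleMeasure N = A z) :
    ∫⁻ z : Fin N → ℂ, (∏ j, f ‖z j‖) * ENNReal.ofReal (G z) =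
      ∫⁻ z : Fin N → ℂ, (∏ j, f ‖z j‖) * ENNReal.ofReal (A z) := by
  have hw : Measurable fun z : Fin N → ℂ => ∏ j, f ‖z j‖ :=
    Finset.measurable_prod _ fun j _ => hf.comp (measurable_pi_apply j).norm
  have hF : Measurable fun z : Fin N → ℂ => (∏ j, f ‖z j‖) * ENNReal.ofReal (G z) :=
    hw.mul hG.measurable.ennreal_ofReal
  have hinv : ∀ x : Fin N → UnitAddCircle,
      ∫⁻ z : Fin N → ℂ, (∏ j, f ‖z j‖) * ENNReal.ofReal (G (rotate x z)) =
        ∫⁻ z : Fin N → ℂ, (∏ j, f ‖z j‖) * ENNReal.ofReal (G z) := by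
    intro x
    rw [← (measurePreserving_rotate x).lintegral_comp hF]
    simp_rw [norm_rotate]
  have hGr : Continuous fun p : (Fin N → UnitAddCircle) × (Fin N → ℂ) => G (rotate p.1 p.2) :=
    hG.comp continuous_rotate
  calc
    _ = ∫⁻ _x, (∫⁻ z : Fin N → ℂ, (∏ j, f ‖z j‖) * ENNReal.ofReal (G z)) ∂angleMeasure N := by
      simp
    _ = ∫⁻ x, (∫⁻ z : Fin N → ℂ, (∏ j, f ‖z j‖) * ENNReal.ofReal (G (rotate x z)))
          ∂angleMeasure N := by simp_rw [hinv]
    _ = ∫⁻ z : Fin N → ℂ, (∫⁻ x, (∏ j, f ‖z j‖) * ENNReal.ofReal (G (rotate x z))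
          ∂angleMeasure N) := by
      apply lintegral_lintegral_swap
      exact ((hw.comp measurable_snd).mul hGr.measurable.ennreal_ofReal).aemeasurable
    _ = _ := by
      refine lintegral_congr fun z => ?_
      have hz : Continuous fun x => G (rotate x z) := hGr.comp (.prodMk_left z)
      rw [lintegral_const_mul _ hz.measurable.ennreal_ofReal, ← hA z,
        ofReal_integral_eq_lintegral_ofReal]
      · exact hz.integrable_of_hasCompactSupport (HasCompactSupport.of_compactSpace _)
      · exact Filter.Eventually.of_forall fun x => hG0 _

/-! ### Block permutations -/

open Equiv in
/-- The permutation of `Fin N × Fin 2` that permutes the blocks `{a} × Fin 2` by `τ` after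
permuting inside each block by `s`. -/
def blockPerm {N : ℕ} (p : Perm (Fin N) × (Fin N → Perm (Fin 2))) : Perm (Fin N × Fin 2) :=
  prodCongrLeft (fun _ => p.1) * prodCongrRight p.2

theorem blockPerm_apply {N : ℕ} (p : Equiv.Perm (Fin N) × (Fin N → Equiv.Perm (Fin 2)))
    (a : Fin N) (t : Fin 2) : blockPerm p (a, t) = (p.1 a, p.2 a t) := rfl

/-- The permutation of the blocks acts alike on both members of the pairs, so it is even and only
the signs inside the blocks remain. -/
theorem sign_blockPerm {N : ℕ} (p : Equiv.Perm (Fin N) × (Fin N → Equiv.Perm (Fin 2))) :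
    Equiv.Perm.sign (blockPerm p) = ∏ a, Equiv.Perm.sign (p.2 a) := by
  rw [blockPerm, Equiv.Perm.sign_mul, Equiv.Perm.sign_prodCongrLeft,
    Equiv.Perm.sign_prodCongrRight, Fin.prod_univ_two, Int.units_mul_self, one_mul]

theorem blockPerm_injective {N : ℕ} : Function.Injective (blockPerm (N := N)) := by
  rintro ⟨τ, s⟩ ⟨τ', s'⟩ h
  have h' : ∀ a t, (τ a, s a t) = (τ' a, s' a t) := fun a t => by
    rw [← blockPerm_apply (τ, s), ← blockPerm_apply (τ', s'), h]
  exact Prod.ext (Equiv.ext fun a => congrArg Prod.fst (h' a 0))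
    (funext fun a => Equiv.ext fun t => congrArg Prod.snd (h' a t))

/-- The position `2 a + t` of `(a, t)` in the lexicographic order. Indices `(a, t)` label the `2 N`
nodes of the symplectic Vandermonde matrix in pairs, and also its exponents. -/
def rowIndex {N : ℕ} (i : Fin N × Fin 2) : ℕ := i.2 + 2 * i.1

theorem rowIndex_injective {N : ℕ} : Function.Injective (rowIndex (N := N)) := by
  rintro ⟨a, s⟩ ⟨b, t⟩ h
  simp only [rowIndex] at h
  ext <;> simp <;> omega

/-- A permutation that maps every block to a pair of neighbouring positions maps blocks to
blocks: position `0` can only be paired with `1`, hence `2` only with `3`, and so on. -/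
theorem fst_eq_of_neighbours {N : ℕ} (σ : Equiv.Perm (Fin N × Fin 2))
    (h : ∀ a, rowIndex (σ (a, 0)) + 1 = rowIndex (σ (a, 1)) ∨
      rowIndex (σ (a, 0)) = rowIndex (σ (a, 1)) + 1) (a : Fin N) :
    (σ (a, 0)).1 = (σ (a, 1)).1 := by
  have hfin : ∀ u t : Fin 2, u = t ∨ u = t + 1 := by decide
  have hpartner : ∀ (k : Fin N) (s : Fin 2), ∃ i t, σ (i, t) = (k, s) ∧ σ.symm (k, s) = (i, t) ∧
      (rowIndex (k, s) + 1 = rowIndex (σ (i, t + 1)) ∨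
        rowIndex (k, s) = rowIndex (σ (i, t + 1)) + 1) := by
    intro k s
    obtain ⟨⟨i, t⟩, hit⟩ := σ.surjective (k, s)
    refine ⟨i, t, hit, by rw [← hit, Equiv.symm_apply_apply], ?_⟩
    rw [← hit]
    fin_cases t
    · simpa using h i
    · simpa [eq_comm, or_comm] using h i
  have key : ∀ n : ℕ, ∀ k : Fin N, (k : ℕ) = n → (σ.symm (k, 0)).1 = (σ.symm (k, 1)).1 := by
    intro n
    induction n with
    | zero =>
      intro k hk
      obtain ⟨i, t, hit, hit', hv⟩ := hpartner k 0
      have : σ (i, t + 1) = (k, 1) := by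
        apply rowIndex_injective
        simp only [rowIndex, hk] at hv ⊢
        simp at hv ⊢
        omega
      rw [hit', ← this, Equiv.symm_apply_apply]
    | succ n ih =>
      intro k hk
      obtain ⟨i, t, hit, hit', hv⟩ := hpartner k 0
      rcases hv with hv | hv
      · have : σ (i, t + 1) = (k, 1) := by
          apply rowIndex_injective
          rw [← hv]
          simp [rowIndex, add_comm]
        rw [hit', ← this, Equiv.symm_apply_apply]
      · have hn : n < N := by omega
        have h1 : σ (i, t + 1) = (⟨n, hn⟩, 1) := by
          apply rowIndex_injective
          simp only [rowIndex, hk] at hv ⊢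
          simp at hv ⊢
          omega
        -- the block `{i} × Fin 2` would have to carry a third position
        have h2 := ih ⟨n, hn⟩ rfl
        rw [← h1, Equiv.symm_apply_apply] at h2
        obtain ⟨u, hu⟩ : ∃ u, σ.symm (⟨n, hn⟩, 0) = (i, u) :=
          ⟨(σ.symm (⟨n, hn⟩, 0)).2, Prod.ext h2 rfl⟩
        rw [Equiv.symm_apply_eq] at hu
        rcases hfin u t with rfl | rfl
        · rw [hit] at hu
          have := congrArg (fun x => (x.1 : ℕ)) hu
          simp at this
          omega
        · rw [h1] at hu
          simp at hu
  obtain ⟨k, s, hks⟩ : ∃ k s, σ (a, 0) = (k, s) := ⟨_, _, rfl⟩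
  have hsym : σ.symm (k, s) = (a, 0) := by rw [← hks, Equiv.symm_apply_apply]
  have hfst : (σ.symm (k, s + 1)).1 = a := by
    have := key _ k rfl
    rcases hfin 0 s with rfl | h0
    · rw [zero_add, ← this, hsym]
    · obtain rfl : s = 1 := by omega
      rw [show (1 : Fin 2) + 1 = 0 from rfl, this, hsym]
  obtain ⟨u, hu⟩ : ∃ u, σ.symm (k, s + 1) = (a, u) :=
    ⟨(σ.symm (k, s + 1)).2, Prod.ext hfst rfl⟩
  rw [Equiv.symm_apply_eq] at hu
  rcases hfin u 0 with rfl | rfl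
  · rw [hks] at hu
    simp at hu
  · rw [zero_add] at hu
    rw [hks, ← hu]

/-- The angular average of `(z - conj z) z ^ p (conj z) ^ q` over the circle of radius `r`. -/
def pairMoment (r : ℝ) (p q : ℕ) : ℝ :=
  if p + 1 = q then r ^ (2 * q) else if p = q + 1 then -r ^ (2 * p) else 0

/-- Interchanging the two members of a pair changes the sign of both the permutation and the pair
moment. -/
theorem pairMoment_blockPerm (r : ℝ) (k : ℕ) (s : Equiv.Perm (Fin 2)) :
    ((Equiv.Perm.sign s : ℤ) : ℝ) * pairMoment r ((s 0 : ℕ) + 2 * k) ((s 1 : ℕ) + 2 * k) =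
      r ^ (4 * k + 2) := by
  have hs : s = 1 ∨ s = Equiv.swap 0 1 := by revert s; decide
  rcases hs with rfl | rfl
  · simp [pairMoment, add_comm]
    ring
  · simp [pairMoment, add_comm]
    rw [if_neg (by omega)]
    ring

/-- Only the block permutations contribute to the Pfaffian-type sum produced by the
Vandermonde determinant with paired nodes, and they all contribute with a positive sign. -/
theorem sum_sign_mul_prod_pairMoment {N : ℕ} (r : Fin N → ℝ) :
    ∑ σ : Equiv.Perm (Fin N × Fin 2), ((Equiv.Perm.sign σ : ℤ) : ℝ) *
        ∏ a, pairMoment (r a) (rowIndex (σ (a, 0))) (rowIndex (σ (a, 1))) =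
      2 ^ N * ∑ τ : Equiv.Perm (Fin N), ∏ a, r a ^ (4 * (τ a : ℕ) + 2) := by
  have hsum : ∑ p : Equiv.Perm (Fin N) × (Fin N → Equiv.Perm (Fin 2)),
      ∏ a, r a ^ (4 * (p.1 a : ℕ) + 2) =
        2 ^ N * ∑ τ : Equiv.Perm (Fin N), ∏ a, r a ^ (4 * (τ a : ℕ) + 2) := by
    rw [Fintype.sum_prod_type, Finset.mul_sum]
    refine Finset.sum_congr rfl fun τ _ => ?_
    simp [Fintype.card_perm]
  rw [← hsum]
  symm
  -- a nonvanishing term comes from a permutation that maps blocks to blocks, i.e. a `blockPerm`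
  refine Finset.sum_of_injOn blockPerm blockPerm_injective.injOn 
    (fun _ _ => Finset.mem_coe.2 (Finset.mem_univ _)) ?_ ?_
  · intro σ _ hσ
    by_contra hne
    apply hσ
    have hprod := right_ne_zero_of_mul hne
    rw [Finset.prod_ne_zero_iff] at hprod
    have hfst := fst_eq_of_neighbours σ fun a => by
      have := hprod a (Finset.mem_univ a)
      unfold pairMoment at this
      grind
    have hfst' : ∀ a t, (σ (a, t)).1 = (σ (a, 0)).1 := by
      intro a t
      fin_cases t
      · rfl
      · exact (hfst a).symm
    have hs : ∀ a, Function.Injective fun t => (σ (a, t)).2 := by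
      intro a t t' htt
      have : σ (a, t) = σ (a, t') := Prod.ext (by rw [hfst' a t, hfst' a t']) htt
      simpa using σ.injective this
    have hτ : Function.Injective fun a => (σ (a, 0)).1 := by
      intro a b hab
      obtain ⟨t, ht⟩ := (Finite.injective_iff_surjective.1 (hs b)) (σ (a, 0)).2
      have : σ (b, t) = σ (a, 0) := Prod.ext (by rw [hfst' b t]; exact hab.symm) ht
      exact (congrArg Prod.fst (σ.injective this)).symm
    refine ⟨(Equiv.ofBijective _ (Finite.injective_iff_bijective.1 hτ),
      fun a => Equiv.ofBijective _ (Finite.injective_iff_bijective.1 (hs a))), by simp, ?_⟩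
    ext1 ⟨a, t⟩
    exact Prod.ext (hfst' a t).symm rfl
  · intro p _
    rw [sign_blockPerm]
    push_cast
    rw [← Finset.prod_mul_distrib]
    refine Finset.prod_congr rfl fun a _ => ?_
    exact (pairMoment_blockPerm (r a) (p.1 a) (p.2 a)).symm

/-! ### Angular averages of the interaction factors -/

/-- The interaction `∏_{j<k} |z_k - z_j|²` of the complex ensemble. -/
noncomputable def complexInteraction {N : ℕ} (z : Fin N → ℂ) : ℝ :=
  ∏ j, ∏ k ∈ Finset.Ioi j, ‖z k - z j‖ ^ 2

/-- The interaction `∏_j |z_j - conj z_j|² ∏_{j<k} |z_k - z_j|² |z_k - conj z_j|²` of the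
symplectic ensemble. -/
noncomputable def symplecticInteraction {N : ℕ} (z : Fin N → ℂ) : ℝ :=
  (∏ j, ‖z j - conj (z j)‖ ^ 2) *
    ∏ j, ∏ k ∈ Finset.Ioi j, ‖z k - z j‖ ^ 2 * ‖z k - conj (z j)‖ ^ 2

theorem complexInteraction_nonneg {N : ℕ} (z : Fin N → ℂ) : 0 ≤ complexInteraction z := by
  unfold complexInteraction; positivity

theorem symplecticInteraction_nonneg {N : ℕ} (z : Fin N → ℂ) : 0 ≤ symplecticInteraction z := by
  unfold symplecticInteraction; positivity

theorem continuous_complexInteraction {N : ℕ} :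
    Continuous (complexInteraction : (Fin N → ℂ) → ℝ) := by
  unfold complexInteraction; fun_prop

theorem continuous_symplecticInteraction {N : ℕ} :
    Continuous (symplecticInteraction : (Fin N → ℂ) → ℝ) := by
  unfold symplecticInteraction; fun_prop

/-- Leibniz expansion of `|Δ(z)|² = Δ(z) conj Δ(z)`. -/
theorem complexInteraction_eq_sum {N : ℕ} (z : Fin N → ℂ) :
    (complexInteraction z : ℂ) = ∑ p : Equiv.Perm (Fin N) × Equiv.Perm (Fin N),
      (((Equiv.Perm.sign p.1 : ℤ) : ℂ) * ((Equiv.Perm.sign p.2 : ℤ) : ℂ)) *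
        ∏ j, z j ^ (p.1 j : ℕ) * conj (z j) ^ (p.2 j : ℕ) := by
  have hdet : ∀ w : Fin N → ℂ, ∏ j, ∏ k ∈ Finset.Ioi j, (w k - w j) =
      ∑ σ : Equiv.Perm (Fin N), ((Equiv.Perm.sign σ : ℤ) : ℂ) * ∏ j, w j ^ (σ j : ℕ) := by
    intro w
    rw [← Matrix.det_vandermonde, ← Matrix.det_transpose, Matrix.det_apply']
    rfl
  have h : (complexInteraction z : ℂ) = (∏ j, ∏ k ∈ Finset.Ioi j, (z k - z j)) *
      ∏ j, ∏ k ∈ Finset.Ioi j, (conj (z k) - conj (z j)) := by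
    simp_rw [← Finset.prod_mul_distrib, ← map_sub, Complex.mul_conj, Complex.normSq_eq_norm_sq]
    simp [complexInteraction]
  rw [h, hdet z, hdet fun j => conj (z j), Finset.sum_mul_sum, ← Finset.sum_product',
    Finset.univ_product_univ]
  refine Finset.sum_congr rfl fun p _ => ?_
  rw [Finset.prod_mul_distrib]
  ring

/-- The angular average of the complex interaction is a permanent. -/
theorem average_complexInteraction {N : ℕ} (z : Fin N → ℂ) :
    ∫ x, complexInteraction (rotate x z) ∂angleMeasure N =
      ∑ σ : Equiv.Perm (Fin N), ∏ j, ‖z j‖ ^ (2 * (σ j : ℕ)) := by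
  apply Complex.ofReal_injective
  rw [← integral_complex_ofReal]
  simp_rw [complexInteraction_eq_sum]
  rw [integral_rotate_sum_prod Finset.univ
    (fun p : Equiv.Perm (Fin N) × Equiv.Perm (Fin N) =>
      ((Equiv.Perm.sign p.1 : ℤ) : ℂ) * ((Equiv.Perm.sign p.2 : ℤ) : ℂ))
    (fun p j w => w ^ (p.1 j : ℕ) * conj w ^ (p.2 j : ℕ))
    (fun p j => (continuous_id.pow _).mul (Complex.continuous_conj.pow _)) z]
  simp_rw [integral_rotate_monomial]
  rw [Fintype.sum_prod_type]
  push_cast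
  refine Finset.sum_congr rfl fun σ _ => ?_
  rw [Finset.sum_eq_single σ]
  -- on the diagonal the two signs cancel; off it some angle has a nonzero frequency
  · rw [← Int.cast_mul, ← Units.val_mul, Int.units_mul_self]
    simp
  · intro τ _ hτ
    obtain ⟨j, hj⟩ : ∃ j, σ j ≠ τ j := by
      by_contra! hcon
      exact hτ (Equiv.ext fun j => (hcon j).symm)
    rw [Finset.prod_eq_zero (Finset.mem_univ j), mul_zero]
    rw [if_neg fun h => hj (Fin.ext h)]
  · simp

/-- The product over pairs of the nodes `v (a, t)`, grouped by blocks. -/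
theorem prod_pairs_finProdFinEquiv {N : ℕ} (v : Fin N × Fin 2 → ℂ) :
    ∏ i, ∏ j ∈ Finset.Ioi i, (v (finProdFinEquiv.symm j) - v (finProdFinEquiv.symm i)) =
      (∏ a, (v (a, 1) - v (a, 0))) * ∏ a, ∏ b ∈ Finset.Ioi a,
        (v (b, 0) - v (a, 0)) * (v (b, 1) - v (a, 0)) *
          ((v (b, 0) - v (a, 1)) * (v (b, 1) - v (a, 1))) := by
  have hIoi : ∀ (n : ℕ) (i : Fin n) (g : Fin n → ℂ),
      ∏ j ∈ Finset.Ioi i, g j = ∏ j, if i < j then g j else 1 := by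
    intro n i g
    rw [← Finset.prod_filter]
    congr 1
    ext; simp
  simp_rw [hIoi]
  rw [← finProdFinEquiv.prod_comp]
  simp_rw [← finProdFinEquiv.prod_comp (fun j => if _ < j then _ else (1 : ℂ)),
    Equiv.symm_apply_apply, Fintype.prod_prod_type, Fin.prod_univ_two]
  rw [← Finset.prod_mul_distrib]
  refine Finset.prod_congr rfl fun a _ => ?_
  have hdiag : v (a, 1) - v (a, 0) = ∏ b, if b = a then v (a, 1) - v (a, 0) else 1 := by simp
  rw [hdiag, ← Finset.prod_mul_distrib, ← Finset.prod_mul_distrib]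
  refine Finset.prod_congr rfl fun b _ => ?_
  simp only [Fin.lt_def, finProdFinEquiv_apply_val]
  rcases lt_trichotomy a b with h | h | h
  · have h' : (a : ℕ) < b := h
    simp [h', h.ne', show 2 * (a : ℕ) < 2 * b by omega, show 2 * (a : ℕ) < 1 + 2 * b by omega,
      show 1 + 2 * (a : ℕ) < 2 * b by omega]
  · subst h
    simp
  · have h' : (b : ℕ) < a := h
    simp [h.ne, show ¬ 2 * (a : ℕ) < 2 * b by omega,
      show ¬ 2 * (a : ℕ) < 1 + 2 * b by omega, show ¬ 1 + 2 * (a : ℕ) < 2 * b by omega, h'.not_gt]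

/-- Leibniz expansion of the symplectic interaction, which equals `∏_j (z_j - conj z_j)` times the
Vandermonde determinant with the nodes `z_1, conj z_1, …, z_N, conj z_N`. -/
theorem symplecticInteraction_eq_sum {N : ℕ} (z : Fin N → ℂ) :
    (symplecticInteraction z : ℂ) = ∑ σ : Equiv.Perm (Fin N × Fin 2),
      ((Equiv.Perm.sign σ : ℤ) : ℂ) * ∏ a, (z a - conj (z a)) *
        (z a ^ rowIndex (σ (a, 0)) * conj (z a) ^ rowIndex (σ (a, 1))) := by
  -- the nodes of the Vandermonde matrix: `z a` at `(a, 0)` and `conj (z a)` at `(a, 1)`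
  let v : Fin N × Fin 2 → ℂ := fun i => if i.2 = 0 then z i.1 else conj (z i.1)
  have hdet : ∑ σ : Equiv.Perm (Fin N × Fin 2), ((Equiv.Perm.sign σ : ℤ) : ℂ) *
      ∏ i, v i ^ rowIndex (σ i) = (∏ a, (v (a, 1) - v (a, 0))) * ∏ a, ∏ b ∈ Finset.Ioi a,
        (v (b, 0) - v (a, 0)) * (v (b, 1) - v (a, 0)) *
          ((v (b, 0) - v (a, 1)) * (v (b, 1) - v (a, 1))) := by
    rw [← prod_pairs_finProdFinEquiv,
      ← Matrix.det_vandermonde fun i => v (finProdFinEquiv.symm i),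
      ← Matrix.det_submatrix_equiv_self finProdFinEquiv, ← Matrix.det_transpose,
      Matrix.det_apply']
    refine Finset.sum_congr rfl fun σ _ => ?_
    congr 1
    refine Finset.prod_congr rfl fun i _ => ?_
    rw [Matrix.transpose_apply, Matrix.submatrix_apply, Matrix.vandermonde_apply,
      Equiv.symm_apply_apply]
    rfl
  simp_rw [Finset.prod_mul_distrib, mul_left_comm _ (∏ a, (z a - conj (z a))), ← Finset.mul_sum]
  have hv : ∀ σ : Equiv.Perm (Fin N × Fin 2), ∏ i, v i ^ rowIndex (σ i) =
      (∏ a, z a ^ rowIndex (σ (a, 0))) * ∏ a, conj (z a) ^ rowIndex (σ (a, 1)) := by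
    intro σ
    rw [Fintype.prod_prod_type, ← Finset.prod_mul_distrib]
    simp [Fin.prod_univ_two, v]
  simp_rw [← hv]
  rw [hdet, ← mul_assoc, ← Finset.prod_mul_distrib]
  unfold symplecticInteraction
  push_cast
  congr 1
  · refine Finset.prod_congr rfl fun a _ => ?_
    rw [← Complex.ofReal_pow, ← Complex.normSq_eq_norm_sq, ← Complex.mul_conj]
    simp [v]
  · refine Finset.prod_congr rfl fun a _ => Finset.prod_congr rfl fun b _ => ?_
    simp_rw [← Complex.ofReal_pow, ← Complex.normSq_eq_norm_sq, ← Complex.mul_conj]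
    simp [v]
    ring

theorem integral_rotate_pair (z : ℂ) (p q : ℕ) :
    ∫ x : UnitAddCircle, ((toCircle x : ℂ) * z - conj ((toCircle x : ℂ) * z)) *
      (((toCircle x : ℂ) * z) ^ p * conj ((toCircle x : ℂ) * z) ^ q) ∂haarAddCircle =
        (pairMoment ‖z‖ p q : ℂ) := by
  have hint : ∀ m n : ℕ, Integrable (fun x : UnitAddCircle =>
      ((toCircle x : ℂ) * z) ^ m * conj ((toCircle x : ℂ) * z) ^ n) haarAddCircle := by
    intro m n
    have hc : Continuous fun x : UnitAddCircle => (toCircle x : ℂ) * z :=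
      continuous_toCircle_coe.mul continuous_const
    exact ((hc.pow m).mul ((Complex.continuous_conj.comp hc).pow n)).integrable_of_hasCompactSupport
      (HasCompactSupport.of_compactSpace _)
  calc
    _ = ∫ x : UnitAddCircle, (((toCircle x : ℂ) * z) ^ (p + 1) * conj ((toCircle x : ℂ) * z) ^ q -
          ((toCircle x : ℂ) * z) ^ p * conj ((toCircle x : ℂ) * z) ^ (q + 1)) ∂haarAddCircle := by
      congr 1
      ext x
      ring
    _ = _ := by
      rw [integral_sub (hint _ _) (hint _ _), integral_rotate_monomial, integral_rotate_monomial]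
      unfold pairMoment
      by_cases h1 : p + 1 = q
      · rw [if_pos h1, if_pos h1, if_neg (by omega), sub_zero, h1]
      · rw [if_neg h1, if_neg h1]
        split_ifs with h2
        · simp
        · simp

/-- The angular average of the symplectic interaction is, up to the factor `2 ^ N`, a permanent. -/
theorem average_symplecticInteraction {N : ℕ} (z : Fin N → ℂ) :
    ∫ x, symplecticInteraction (rotate x z) ∂angleMeasure N =
      2 ^ N * ∑ σ : Equiv.Perm (Fin N), ∏ j, ‖z j‖ ^ (4 * (σ j : ℕ) + 2) := by
  rw [← sum_sign_mul_prod_pairMoment]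
  apply Complex.ofReal_injective
  rw [← integral_complex_ofReal]
  simp_rw [symplecticInteraction_eq_sum]
  rw [integral_rotate_sum_prod Finset.univ
    (fun σ : Equiv.Perm (Fin N × Fin 2) => ((Equiv.Perm.sign σ : ℤ) : ℂ))
    (fun σ a w => (w - conj w) *
      (w ^ rowIndex (σ (a, 0)) * conj w ^ rowIndex (σ (a, 1))))
    (fun σ a => (continuous_id.sub Complex.continuous_conj).mul
      ((continuous_id.pow _).mul (Complex.continuous_conj.pow _))) z]
  simp_rw [integral_rotate_pair]
  push_cast
  rfl

/-! ### Partition integrals as products of moments -/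

/-- The moment `∫ f(|z|) |z|^m d²z` of a radial weight. -/
noncomputable def radialMoment (f : ℝ → ℝ≥0∞) (m : ℕ) : ℝ≥0∞ :=
  ∫⁻ z : ℂ, f ‖z‖ * ENNReal.ofReal (‖z‖ ^ m)

/-- The integral of a permanent of radial monomials against a radial weight. -/
theorem lintegral_radial_mul_permanent {N : ℕ} (f : ℝ → ℝ≥0∞) (hf : Measurable f) (m : Fin N → ℕ) :
    ∫⁻ z : Fin N → ℂ, (∏ j, f ‖z j‖) *
        ENNReal.ofReal (∑ σ : Equiv.Perm (Fin N), ∏ j, ‖z j‖ ^ m (σ j)) =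
      N.factorial * ∏ k, radialMoment f (m k) := by
  have hmeas : ∀ n : ℕ, Measurable fun w : ℂ => f ‖w‖ * ENNReal.ofReal (‖w‖ ^ n) := fun n =>
    (hf.comp measurable_norm).mul (measurable_norm.pow_const n).ennreal_ofReal
  have h : ∀ z : Fin N → ℂ, (∏ j, f ‖z j‖) *
      ENNReal.ofReal (∑ σ : Equiv.Perm (Fin N), ∏ j, ‖z j‖ ^ m (σ j)) =
        ∑ σ : Equiv.Perm (Fin N), ∏ j, f ‖z j‖ * ENNReal.ofReal (‖z j‖ ^ m (σ j)) := by
    intro z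
    rw [ENNReal.ofReal_sum_of_nonneg fun σ _ => by positivity, Finset.mul_sum]
    refine Finset.sum_congr rfl fun σ _ => ?_
    rw [ENNReal.ofReal_prod_of_nonneg fun j _ => by positivity, Finset.prod_mul_distrib]
  simp_rw [h]
  rw [lintegral_finsetSum _ fun σ _ => Finset.measurable_prod _ fun j _ =>
    (hmeas (m (σ j))).comp (measurable_pi_apply j)]
  have hσ : ∀ σ : Equiv.Perm (Fin N), ∫⁻ z : Fin N → ℂ,
      ∏ j, f ‖z j‖ * ENNReal.ofReal (‖z j‖ ^ m (σ j)) = ∏ k, radialMoment f (m k) := by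
    intro σ
    rw [volume_pi, lintegral_fin_prod_eq_prod volume
      (fun j w => f ‖w‖ * ENNReal.ofReal (‖w‖ ^ m (σ j))) fun j => hmeas (m (σ j))]
    exact Equiv.prod_comp σ fun k => radialMoment f (m k)
  simp_rw [hσ]
  simp [Fintype.card_perm]

theorem lintegral_complexInteraction {N : ℕ} (f : ℝ → ℝ≥0∞) (hf : Measurable f) :
    ∫⁻ z : Fin N → ℂ, (∏ j, f ‖z j‖) * ENNReal.ofReal (complexInteraction z) =
      N.factorial * ∏ k : Fin N, radialMoment f (2 * k) := by
  rw [lintegral_radial_mul_eq_average f hf _ _ continuous_complexInteraction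
    complexInteraction_nonneg average_complexInteraction]
  exact lintegral_radial_mul_permanent f hf fun k => 2 * (k : ℕ)

/-- The reflection of a complex number into the upper half-plane. -/
noncomputable def foldUp (z : ℂ) : ℂ := if 0 < z.im then z else conj z

theorem measurable_foldUp : Measurable foldUp :=
  Measurable.ite (measurableSet_lt measurable_const Complex.measurable_im) measurable_id
    Complex.continuous_conj.measurable

theorem foldUp_eq_or (z : ℂ) : foldUp z = z ∨ foldUp z = conj z := by
  unfold foldUp; split_ifs <;> simp

theorem norm_foldUp (z : ℂ) : ‖foldUp z‖ = ‖z‖ := by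
  rcases foldUp_eq_or z with h | h <;> simp [h]

theorem measurableSet_upper : MeasurableSet {z : ℂ | 0 < z.im} :=
  measurableSet_lt measurable_const Complex.measurable_im

theorem volume_im_eq_zero : volume {z : ℂ | z.im = 0} = 0 := by
  have h := Measure.addHaar_submodule (volume : Measure ℂ)
    (LinearMap.ker Complex.imLm) (by
      intro h
      have : Complex.I ∈ LinearMap.ker Complex.imLm := h ▸ Submodule.mem_top
      simp at this)
  exact h

/-- The real axis being null, folding the plane doubles the measure of the upper half-plane. -/
theorem map_foldUp : (volume : Measure ℂ).map foldUp = 2 • volume.restrict {z : ℂ | 0 < z.im} := by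
  ext s hs
  have hc : MeasurePreserving (conj : ℂ → ℂ) := Complex.conjLIE.measurePreserving
  set U : Set ℂ := {z | 0 < z.im} with hU
  have hUm : MeasurableSet U := measurableSet_upper
  have hUc : Uᶜ =ᵐ[volume] (conj : ℂ → ℂ) ⁻¹' U := by
    have h0 : ∀ᵐ z : ℂ, z.im ≠ 0 := by
      rw [ae_iff]; simpa using volume_im_eq_zero
    filter_upwards [h0] with z hz
    apply propext
    show ¬ 0 < z.im ↔ 0 < (conj z).im
    rw [Complex.conj_im, neg_pos, not_lt]
    exact ⟨fun h => lt_of_le_of_ne h hz, le_of_lt⟩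
  rw [Measure.map_apply measurable_foldUp hs, Measure.smul_apply, Measure.restrict_apply hs,
    ← measure_inter_add_sdiff _ hUm]
  have h1 : foldUp ⁻¹' s ∩ U = s ∩ U := by
    ext z
    simp only [Set.mem_inter_iff, Set.mem_preimage]
    refine and_congr_left fun hz => ?_
    rw [foldUp, if_pos (show 0 < z.im from hz)]
  have h2 : foldUp ⁻¹' s \ U = (conj : ℂ → ℂ) ⁻¹' s ∩ Uᶜ := by
    ext z
    simp only [Set.mem_sdiff, Set.mem_inter_iff, Set.mem_preimage, Set.mem_compl_iff]
    refine and_congr_left fun hz => ?_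
    rw [foldUp, if_neg (show ¬ 0 < z.im from hz)]
  have h3 : volume ((conj : ℂ → ℂ) ⁻¹' s ∩ Uᶜ) = volume (s ∩ U) := by
    refine (measure_congr (ae_eq_set_inter (Filter.EventuallyEq.refl _ _) hUc)).trans ?_
    rw [← Set.preimage_inter, hc.measure_preimage (hs.inter hUm).nullMeasurableSet]
  rw [h1, h2, h3, two_nsmul]

/-- A function invariant under complex conjugation of single particles has the same integral over
each of the `2 ^ N` products of half-planes. -/
theorem lintegral_eq_two_pow_mul_upper {N : ℕ} (F : (Fin N → ℂ) → ℝ≥0∞) (hF : Measurable F)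
    (hinv : ∀ z, F (fun j => foldUp (z j)) = F z) :
    ∫⁻ z, F z = 2 ^ N * ∫⁻ z in upperConfigurations N, F z := by
  have hset : upperConfigurations N = Set.univ.pi fun _ => {z : ℂ | 0 < z.im} := by
    ext z; simp [upperConfigurations]
  have hpi : (volume : Measure (Fin N → ℂ)).map (fun z j => foldUp (z j)) =
      (2 ^ N : ℝ≥0∞) • volume.restrict (upperConfigurations N) := by
    have : SigmaFinite ((volume : Measure ℂ).map foldUp) := by
      rw [map_foldUp, two_nsmul]; infer_instance
    rw [volume_pi, Measure.pi_map_pi fun _ => measurable_foldUp.aemeasurable, hset,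
      Measure.restrict_pi_pi, map_foldUp]
    have : SigmaFinite (2 • (volume : Measure ℂ).restrict {z : ℂ | 0 < z.im}) := by
      rw [two_nsmul]; infer_instance
    refine Measure.pi_eq fun s _ => ?_
    simp [Measure.smul_apply, Measure.pi_pi, Finset.prod_mul_distrib]
  have hm : Measurable fun (z : Fin N → ℂ) j => foldUp (z j) :=
    measurable_pi_lambda _ fun j => measurable_foldUp.comp (measurable_pi_apply j)
  rw [← smul_eq_mul, ← lintegral_smul_measure, ← hpi, lintegral_map hF hm]
  simp_rw [hinv]

theorem symplecticInteraction_foldUp {N : ℕ} (z : Fin N → ℂ) :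
    symplecticInteraction (fun j => foldUp (z j)) = symplecticInteraction z := by
  have hc : ∀ a b : ℂ, ‖conj a - b‖ = ‖a - conj b‖ := fun a b => by
    rw [← Complex.norm_conj]; simp
  unfold symplecticInteraction
  congr 1
  · refine Finset.prod_congr rfl fun j _ => ?_
    rcases foldUp_eq_or (z j) with h | h
    · simp only [h]
    · simp only [h, Complex.conj_conj, norm_sub_rev]
  · refine Finset.prod_congr rfl fun j _ => Finset.prod_congr rfl fun k _ => ?_
    rcases foldUp_eq_or (z j) with h | h <;> rcases foldUp_eq_or (z k) with h' | h' <;>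
      simp only [h, h', hc, Complex.conj_conj] <;> ring

theorem setLIntegral_symplecticInteraction {N : ℕ} (f : ℝ → ℝ≥0∞) (hf : Measurable f) :
    ∫⁻ z in upperConfigurations N, (∏ j, f ‖z j‖) * ENNReal.ofReal (symplecticInteraction z) =
      N.factorial * ∏ k : Fin N, radialMoment f (4 * k + 2) := by
  have h2 : (2 : ℝ≥0∞) ^ N ≠ 0 := by simp
  have h2' : (2 : ℝ≥0∞) ^ N ≠ ⊤ := by simp
  rw [← ENNReal.mul_right_inj h2 h2', ← lintegral_eq_two_pow_mul_upper]
  · rw [lintegral_radial_mul_eq_average f hf _ _ continuous_symplecticInteraction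
      symplecticInteraction_nonneg average_symplecticInteraction]
    simp_rw [ENNReal.ofReal_mul (show (0 : ℝ) ≤ 2 ^ N by positivity),
      mul_left_comm _ (ENNReal.ofReal (2 ^ N))]
    rw [lintegral_const_mul' _ _ ENNReal.ofReal_ne_top,
      lintegral_radial_mul_permanent f hf fun k => 4 * (k : ℕ) + 2]
    congr 1
    rw [ENNReal.ofReal_pow zero_le_two, ENNReal.ofReal_ofNat]
  · exact (Finset.measurable_prod _ fun j _ => hf.comp (measurable_pi_apply j).norm).mul
      continuous_symplecticInteraction.measurable.ennreal_ofReal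
  · intro z
    simp_rw [norm_foldUp, symplecticInteraction_foldUp]

/-! ### Radial moments under the squaring map -/

theorem radialMoment_eq_lintegral_Ioi (f : ℝ → ℝ≥0∞) (hf : Measurable f) (m : ℕ) :
    radialMoment f m = ENNReal.ofReal (2 * Real.pi) *
      ∫⁻ r in Set.Ioi (0 : ℝ), f r * ENNReal.ofReal (r ^ (m + 1)) := by
  have hg : Measurable fun r : ℝ => f r * ENNReal.ofReal (r ^ (m + 1)) :=
    hf.mul (measurable_id.pow_const _).ennreal_ofReal
  rw [radialMoment, ← Complex.lintegral_comp_polarCoord_symm, polarCoord_target]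
  simp_rw [Complex.norm_polarCoord_symm]
  calc
    _ = ∫⁻ p in Set.Ioi (0 : ℝ) ×ˢ Set.Ioo (-Real.pi) Real.pi,
          f p.1 * ENNReal.ofReal (p.1 ^ (m + 1)) := by
      refine setLIntegral_congr_fun (measurableSet_Ioi.prod measurableSet_Ioo) fun p hp => ?_
      have h0 : 0 < p.1 := hp.1
      simp only [smul_eq_mul, abs_of_pos h0]
      rw [pow_succ', ENNReal.ofReal_mul h0.le]
      ring
    _ = ∫⁻ p, (f p.1 * ENNReal.ofReal (p.1 ^ (m + 1))) * 1
          ∂((volume.restrict (Set.Ioi (0 : ℝ))).prod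
            (volume.restrict (Set.Ioo (-Real.pi) Real.pi))) := by
      rw [Measure.prod_restrict, ← Measure.volume_eq_prod]
      simp
    _ = _ := by
      rw [lintegral_prod_mul (f := fun r : ℝ => f r * ENNReal.ofReal (r ^ (m + 1)))
        (g := fun _ => 1) hg.aemeasurable aemeasurable_const]
      rw [mul_comm]
      congr 1
      simp [← two_mul]

/-- The substitution `u = c r²` on the half-line. -/
theorem lintegral_Ioi_comp_mul_sq {c : ℝ} (hc : 0 < c) (g : ℝ → ℝ≥0∞) :
    ∫⁻ u in Set.Ioi (0 : ℝ), g u =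
      ∫⁻ r in Set.Ioi (0 : ℝ), ENNReal.ofReal (2 * c * r) * g (c * r ^ 2) := by
  have himg : (fun r : ℝ => c * r ^ 2) '' Set.Ioi 0 = Set.Ioi 0 := by
    ext u
    simp only [Set.mem_image, Set.mem_Ioi]
    constructor
    · rintro ⟨r, hr, rfl⟩
      positivity
    · intro hu
      refine ⟨√(u / c), Real.sqrt_pos.2 (by positivity), ?_⟩
      rw [Real.sq_sqrt (by positivity)]
      field_simp
  have h := lintegral_image_eq_lintegral_abs_deriv_mul (s := Set.Ioi (0 : ℝ))
    (f := fun r : ℝ => c * r ^ 2) (f' := fun r => 2 * c * r) measurableSet_Ioi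
    (fun r _ => by
      have h2 : 2 * c * r = c * ((2 : ℕ) * r ^ (2 - 1)) := by norm_num; ring
      rw [h2]
      exact ((hasDerivAt_pow 2 r).const_mul c).hasDerivWithinAt)
    (fun r hr s hs hrs => by
      have hr' : (0 : ℝ) < r := hr
      have hs' : (0 : ℝ) < s := hs
      have : r ^ 2 = s ^ 2 := mul_left_cancel₀ hc.ne' hrs
      exact (pow_left_inj₀ hr'.le hs'.le two_ne_zero).1 this) g
  rw [himg] at h
  rw [h]
  refine setLIntegral_congr_fun measurableSet_Ioi fun r hr => ?_
  have hr' : (0 : ℝ) < r := hr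
  simp only [abs_of_pos (show 0 < 2 * c * r by positivity)]

/-- If the weights `fH` and `fC` are matched by the map `r ↦ c r²`, then so are the moments entering
the two partition functions. -/
theorem radialMoment_of_comp_mul_sq {fH fC : ℝ → ℝ≥0∞} (hfH : Measurable fH) (hfC : Measurable fC)
    {c : ℝ} (hc : 0 < c) {K : ℝ≥0∞} (hK : K ≠ ⊤)
    (h : ∀ r, 0 < r → fH r = K * fC (c * r ^ 2)) (k : ℕ) :
    radialMoment fH (4 * k + 2) =
      (K * ENNReal.ofReal ((2 * c ^ (2 * k + 2))⁻¹)) * radialMoment fC (2 * k) := by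
  rw [radialMoment_eq_lintegral_Ioi _ hfH, radialMoment_eq_lintegral_Ioi _ hfC,
    lintegral_Ioi_comp_mul_sq hc fun u => fC u * ENNReal.ofReal (u ^ (2 * k + 1)), mul_left_comm]
  congr 1
  rw [← lintegral_const_mul' _ _ (ENNReal.mul_ne_top hK ENNReal.ofReal_ne_top)]
  refine setLIntegral_congr_fun measurableSet_Ioi fun r hr => ?_
  have hr' : (0 : ℝ) < r := hr
  have hpow : r ^ (4 * k + 2 + 1) =
      (2 * c ^ (2 * k + 2))⁻¹ * ((2 * c * r) * (c * r ^ 2) ^ (2 * k + 1)) := by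
    field_simp
    ring
  rw [h r hr', hpow, ENNReal.ofReal_mul (by positivity), ENNReal.ofReal_mul (by positivity)]
  ring

/-! ### Gap probabilities as ratios of partition integrals -/

/-- The Boltzmann factor `e^{-ω}` of the complex ensemble, as a function of the radius. -/
noncomputable def complexFactor (ω : ℝ → EReal) (r : ℝ) : ℝ≥0∞ := EReal.exp (-(ω r))

/-- The Boltzmann factor `e^{-2ω}` of the symplectic ensemble, as a function of the radius. -/
noncomputable def symplecticFactor (ω : ℝ → EReal) (r : ℝ) : ℝ≥0∞ := EReal.exp (-(2 * ω r))

theorem measurable_complexFactor {ω : ℝ → EReal} (hω : Measurable ω) :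
    Measurable (complexFactor ω) :=
  EReal.measurable_exp.comp hω.neg

theorem complexWeight_radial {N : ℕ} (ω : ℝ → EReal) (z : Fin N → ℂ) :
    complexWeight N (radialPotential ω) z =
      (∏ j, complexFactor ω ‖z j‖) * ENNReal.ofReal (complexInteraction z) := by
  rw [complexWeight, complexInteraction, ENNReal.ofReal_prod_of_nonneg fun j _ => by positivity]
  simp_rw [ENNReal.ofReal_prod_of_nonneg fun (k : Fin N) (_ : k ∈ Finset.Ioi _) =>
    sq_nonneg ‖z k - z _‖]
  rfl

theorem symplecticWeight_radial {N : ℕ} (ω : ℝ → EReal) (z : Fin N → ℂ) :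
    symplecticWeight N (radialPotential ω) z =
      (∏ j, symplecticFactor ω ‖z j‖) * ENNReal.ofReal (symplecticInteraction z) := by
  rw [symplecticWeight, symplecticInteraction, ENNReal.ofReal_mul (by positivity),
    ENNReal.ofReal_prod_of_nonneg fun j _ => by positivity,
    ENNReal.ofReal_prod_of_nonneg fun j _ => by positivity, Finset.prod_mul_distrib, mul_assoc]
  have h : ∀ j, ENNReal.ofReal (∏ k ∈ Finset.Ioi j, ‖z k - z j‖ ^ 2 * ‖z k - conj (z j)‖ ^ 2) =
      ∏ k ∈ Finset.Ioi j, ENNReal.ofReal (‖z k - z j‖ ^ 2 * ‖z k - conj (z j)‖ ^ 2) :=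
    fun j => ENNReal.ofReal_prod_of_nonneg fun k _ => by positivity
  simp_rw [h]
  rfl

open Classical in
/-- The radial weight `f`, set to zero at the radii belonging to `D`. -/
noncomputable def gapWeight (f : ℝ → ℝ≥0∞) (D : Set ℂ) (r : ℝ) : ℝ≥0∞ :=
  if (r : ℂ) ∈ D then 0 else f r

theorem measurable_gapWeight {f : ℝ → ℝ≥0∞} (hf : Measurable f) {D : Set ℂ}
    (hD : MeasurableSet D) : Measurable (gapWeight f D) := by
  classical
  exact Measurable.ite (Complex.measurable_ofReal hD) measurable_const hf

theorem gapWeight_empty (f : ℝ → ℝ≥0∞) : gapWeight f ∅ = f := by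
  ext r; simp [gapWeight]

theorem IsRadiallySymmetric.ofReal_norm_mem {D : Set ℂ} (hD : IsRadiallySymmetric D) (z : ℂ) :
    (‖z‖ : ℂ) ∈ D ↔ z ∈ D :=
  ⟨hD _ _ (by simp), hD _ _ (by simp)⟩

/-- Restricting to the configurations that avoid a radially symmetric set amounts to modifying the
one-particle weight. -/
theorem indicator_gap_eq {N : ℕ} (f : ℝ → ℝ≥0∞) (G : (Fin N → ℂ) → ℝ≥0∞) {D : Set ℂ}
    (hD : IsRadiallySymmetric D) :
    {z : Fin N → ℂ | ∀ j, z j ∉ D}.indicator (fun z => (∏ j, f ‖z j‖) * G z) =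
      fun z => (∏ j, gapWeight f D ‖z j‖) * G z := by
  ext z
  by_cases hz : ∀ j, z j ∉ D
  · rw [Set.indicator_of_mem (by exact hz)]
    congr 1
    refine Finset.prod_congr rfl fun j _ => ?_
    rw [gapWeight, if_neg (by rw [hD.ofReal_norm_mem]; exact hz j)]
  · rw [Set.indicator_of_notMem (by exact hz)]
    push Not at hz
    obtain ⟨j, hj⟩ := hz
    rw [Finset.prod_eq_zero (Finset.mem_univ j), zero_mul]
    rw [gapWeight, if_pos ((hD.ofReal_norm_mem _).2 hj)]

theorem measurableSet_gap {N : ℕ} {D : Set ℂ} (hDm : MeasurableSet D) :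
    MeasurableSet {z : Fin N → ℂ | ∀ j, z j ∉ D} := by
  rw [Set.ofPred_forall]
  exact MeasurableSet.iInter fun j =>
    (measurable_pi_apply j : Measurable fun z : Fin N → ℂ => z j) hDm.compl

theorem factorial_mul_complexPartition (N : ℕ) {ω : ℝ → EReal}
    (hω : Measurable (complexFactor ω)) :
    (N.factorial : ℝ≥0∞) * complexPartition N (radialPotential ω) =
      N.factorial * ∏ k : Fin N, radialMoment (complexFactor ω) (2 * k) := by
  rw [complexPartition, ENNReal.mul_div_cancel (by exact_mod_cast N.factorial_ne_zero)
    (ENNReal.natCast_ne_top _)]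
  simp_rw [complexWeight_radial]
  exact lintegral_complexInteraction _ hω

theorem factorial_mul_symplecticPartition (N : ℕ) {ω : ℝ → EReal}
    (hω : Measurable (symplecticFactor ω)) :
    (N.factorial : ℝ≥0∞) * symplecticPartition N (radialPotential ω) =
      N.factorial * ∏ k : Fin N, radialMoment (symplecticFactor ω) (4 * k + 2) := by
  rw [symplecticPartition, ENNReal.mul_div_cancel (by exact_mod_cast N.factorial_ne_zero)
    (ENNReal.natCast_ne_top _)]
  simp_rw [symplecticWeight_radial]
  exact setLIntegral_symplecticInteraction _ hω

theorem factorial_mul_div_factorial_mul (N : ℕ) (a b : ℝ≥0∞) :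
    (N.factorial * a) / (N.factorial * b) = a / b :=
  ENNReal.mul_div_mul_left _ _ (by exact_mod_cast N.factorial_ne_zero) (ENNReal.natCast_ne_top _)

theorem gapProbability_complexEnsemble (N : ℕ) {ω : ℝ → EReal}
    (hω : Measurable (complexFactor ω)) {D : Set ℂ} (hDm : MeasurableSet D)
    (hD : IsRadiallySymmetric D) :
    gapProbability (complexEnsemble N (radialPotential ω)) D =
      (∏ k : Fin N, radialMoment (gapWeight (complexFactor ω) D) (2 * k)) /
        ∏ k : Fin N, radialMoment (complexFactor ω) (2 * k) := by
  have hgap := measurableSet_gap (N := N) hDm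
  have hg := measurable_gapWeight hω hDm
  rw [gapProbability, complexEnsemble, withDensity_apply _ hgap,
    factorial_mul_complexPartition N hω]
  simp_rw [complexWeight_radial, div_eq_mul_inv]
  rw [lintegral_mul_const, ← lintegral_indicator hgap, indicator_gap_eq _ _ hD,
    lintegral_complexInteraction _ hg, ← div_eq_mul_inv, ← div_eq_mul_inv,
    factorial_mul_div_factorial_mul]
  exact (Finset.measurable_prod _ fun j _ => hω.comp (measurable_pi_apply j).norm).mul
    continuous_complexInteraction.measurable.ennreal_ofReal

theorem gapProbability_symplecticEnsemble (N : ℕ) {ω : ℝ → EReal}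
    (hω : Measurable (symplecticFactor ω)) {D : Set ℂ} (hDm : MeasurableSet D)
    (hD : IsRadiallySymmetric D) :
    gapProbability (symplecticEnsemble N (radialPotential ω)) D =
      (∏ k : Fin N, radialMoment (gapWeight (symplecticFactor ω) D) (4 * k + 2)) /
        ∏ k : Fin N, radialMoment (symplecticFactor ω) (4 * k + 2) := by
  have hgap := measurableSet_gap (N := N) hDm
  have hg := measurable_gapWeight hω hDm
  rw [gapProbability, symplecticEnsemble, withDensity_apply _ hgap,
    factorial_mul_symplecticPartition N hω]
  simp_rw [symplecticWeight_radial, div_eq_mul_inv]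
  rw [lintegral_mul_const, ← lintegral_indicator hgap, indicator_gap_eq _ _ hD,
    setLIntegral_symplecticInteraction _ hg, ← div_eq_mul_inv, ← div_eq_mul_inv,
    factorial_mul_div_factorial_mul]
  exact (Finset.measurable_prod _ fun j _ => hω.comp (measurable_pi_apply j).norm).mul
    continuous_symplecticInteraction.measurable.ennreal_ofReal

theorem isRadiallySymmetric_empty : IsRadiallySymmetric ∅ := fun _ _ _ h => h

theorem isProbabilityMeasure_of_gapProbability_empty {N : ℕ} {μ : Measure (Fin N → ℂ)}
    (h : gapProbability μ ∅ = 1) : IsProbabilityMeasure μ :=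
  ⟨by simpa [gapProbability] using h⟩

/-! ### Matching the two ensembles -/

theorem mem_image_smul_sq_iff {D : Set ℂ} (hD : IsRadiallySymmetric D) {c : ℝ} (hc : 0 < c)
    (w : ℂ) : w ∈ (fun z : ℂ => c • z ^ 2) '' D ↔ ((√(‖w‖ / c) : ℝ) : ℂ) ∈ D := by
  have hn : ∀ z : ℂ, c • z ^ 2 = w → √(‖w‖ / c) = ‖z‖ := by
    rintro z rfl
    rw [norm_smul, norm_pow, Real.norm_of_nonneg hc.le, mul_div_cancel_left₀ _ hc.ne',
      Real.sqrt_sq (norm_nonneg z)]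
  constructor
  · rintro ⟨z, hz, hzw⟩
    rw [hn z hzw, hD.ofReal_norm_mem]
    exact hz
  · intro h
    obtain ⟨z, hz⟩ := IsAlgClosed.exists_pow_nat_eq (c⁻¹ • w) zero_lt_two
    have hzw : c • z ^ 2 = w := by rw [hz, smul_inv_smul₀ hc.ne']
    rw [hn z hzw, hD.ofReal_norm_mem] at h
    exact ⟨z, h, hzw⟩

theorem isRadiallySymmetric_image_smul_sq {D : Set ℂ} (hD : IsRadiallySymmetric D) {c : ℝ}
    (hc : 0 < c) : IsRadiallySymmetric ((fun z : ℂ => c • z ^ 2) '' D) := by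
  intro z w hzw hz
  rw [mem_image_smul_sq_iff hD hc] at hz ⊢
  rwa [← hzw]

theorem measurableSet_image_smul_sq {D : Set ℂ} (hDm : MeasurableSet D)
    (hD : IsRadiallySymmetric D) {c : ℝ} (hc : 0 < c) :
    MeasurableSet ((fun z : ℂ => c • z ^ 2) '' D) := by
  have h : (fun z : ℂ => c • z ^ 2) '' D = (fun w : ℂ => ((√(‖w‖ / c) : ℝ) : ℂ)) ⁻¹' D := by
    ext w
    exact mem_image_smul_sq_iff hD hc w
  rw [h]
  exact (Complex.measurable_ofReal.comp (measurable_norm.div_const c).sqrt) hDm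

theorem gapWeight_of_comp_mul_sq {fH fC : ℝ → ℝ≥0∞} {D : Set ℂ} (hD : IsRadiallySymmetric D)
    {c : ℝ} (hc : 0 < c) {K : ℝ≥0∞} (h : ∀ r, 0 < r → fH r = K * fC (c * r ^ 2)) (r : ℝ)
    (hr : 0 < r) :
    gapWeight fH D r = K * gapWeight fC ((fun z : ℂ => c • z ^ 2) '' D) (c * r ^ 2) := by
  have hmem : ((c * r ^ 2 : ℝ) : ℂ) ∈ (fun z : ℂ => c • z ^ 2) '' D ↔ (r : ℂ) ∈ D := by
    rw [mem_image_smul_sq_iff hD hc, Complex.norm_real, Real.norm_of_nonneg (by positivity),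
      mul_div_cancel_left₀ _ hc.ne', Real.sqrt_sq hr.le]
  unfold gapWeight
  by_cases hrD : (r : ℂ) ∈ D
  · rw [if_pos hrD, if_pos (hmem.2 hrD), mul_zero]
  · rw [if_neg hrD, if_neg (mt hmem.1 hrD), h r hr]

/-- The comparison of the two ensembles when their weights are matched by `r ↦ c r²`: the moments
of the symplectic ensemble, with or without a gap, are those of the complex ensemble up to factors
that do not depend on the gap. -/
theorem symplectic_complex_of_matched (N : ℕ) {D : Set ℂ} (hDm : MeasurableSet D)
    (hD : IsRadiallySymmetric D) {ωH ωC : ℝ → EReal} (hH : Measurable (symplecticFactor ωH))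
    (hC : Measurable (complexFactor ωC)) {c : ℝ} (hc : 0 < c) {K : ℝ≥0∞} (hK0 : K ≠ 0)
    (hK : K ≠ ⊤) (h : ∀ r, 0 < r → symplecticFactor ωH r = K * complexFactor ωC (c * r ^ 2))
    (hZ0 : ∏ k : Fin N, radialMoment (complexFactor ωC) (2 * k) ≠ 0)
    (hZ : ∏ k : Fin N, radialMoment (complexFactor ωC) (2 * k) ≠ ⊤) :
    IsProbabilityMeasure (symplecticEnsemble N (radialPotential ωH)) ∧
      IsProbabilityMeasure (complexEnsemble N (radialPotential ωC)) ∧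
      gapProbability (symplecticEnsemble N (radialPotential ωH)) D =
        gapProbability (complexEnsemble N (radialPotential ωC))
          ((fun z : ℂ => c • z ^ 2) '' D) := by
  set a : Fin N → ℝ≥0∞ := fun k => K * ENNReal.ofReal ((2 * c ^ (2 * (k : ℕ) + 2))⁻¹)
  have ha0 : ∏ k, a k ≠ 0 := Finset.prod_ne_zero_iff.2 fun k _ =>
    mul_ne_zero hK0 (ENNReal.ofReal_pos.2 (by positivity)).ne'
  have ha1 : ∏ k, a k ≠ ⊤ := ENNReal.prod_ne_top fun k _ =>
    ENNReal.mul_ne_top hK ENNReal.ofReal_ne_top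
  have hprod : ∀ {fH fC : ℝ → ℝ≥0∞}, Measurable fH → Measurable fC →
      (∀ r, 0 < r → fH r = K * fC (c * r ^ 2)) →
      ∏ k : Fin N, radialMoment fH (4 * k + 2) =
        (∏ k, a k) * ∏ k : Fin N, radialMoment fC (2 * k) := by
    intro fH fC hfH hfC hm
    rw [← Finset.prod_mul_distrib]
    exact Finset.prod_congr rfl fun k _ => radialMoment_of_comp_mul_sq hfH hfC hc hK hm k
  have hgap : ∀ E : Set ℂ, MeasurableSet E → IsRadiallySymmetric E →
      gapProbability (symplecticEnsemble N (radialPotential ωH)) E =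
        gapProbability (complexEnsemble N (radialPotential ωC))
          ((fun z : ℂ => c • z ^ 2) '' E) := by
    intro E hEm hE
    have hEm' := measurableSet_image_smul_sq hEm hE hc
    rw [gapProbability_symplecticEnsemble N hH hEm hE,
      gapProbability_complexEnsemble N hC hEm' (isRadiallySymmetric_image_smul_sq hE hc)]
    rw [hprod hH hC h, hprod (measurable_gapWeight hH hEm) (measurable_gapWeight hC hEm')
      (gapWeight_of_comp_mul_sq hE hc h)]
    exact ENNReal.mul_div_mul_left _ _ ha0 ha1
  have hC1 : gapProbability (complexEnsemble N (radialPotential ωC)) ∅ = 1 := by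
    rw [gapProbability_complexEnsemble N hC MeasurableSet.empty isRadiallySymmetric_empty,
      gapWeight_empty, ENNReal.div_self hZ0 hZ]
  have hH1 := hgap ∅ MeasurableSet.empty isRadiallySymmetric_empty
  rw [Set.image_empty, hC1] at hH1
  exact ⟨isProbabilityMeasure_of_gapProbability_empty hH1,
    isProbabilityMeasure_of_gapProbability_empty hC1, hgap D hDm hD⟩

theorem symplecticFactor_symplecticProfile (ω : ℝ → EReal) (r : ℝ) :
    symplecticFactor (symplecticProfile ω) r = complexFactor ω (r ^ 2) := by
  have h2 : (2 : EReal) * ((1 / 2 : ℝ) : EReal) = 1 := by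
    rw [show (2 : EReal) = ((2 : ℝ) : EReal) from rfl, ← EReal.coe_mul]
    norm_num
  rw [symplecticFactor, symplecticProfile, complexFactor, ← mul_assoc, h2, one_mul]

/-! ### Mittag-Leffler potentials -/

theorem measurable_mittagLefflerProfile (α b : ℝ) :
    Measurable fun r : ℝ => r ^ (2 * b) - 2 * α * Real.log r := by
  fun_prop

theorem complexFactor_mittagLeffler (α b r : ℝ) : complexFactor (mittagLefflerProfile α b) r =
    ENNReal.ofReal (Real.exp (-(r ^ (2 * b) - 2 * α * Real.log r))) := rfl

theorem symplecticFactor_mittagLeffler (α b r : ℝ) :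
    symplecticFactor (mittagLefflerProfile α b) r =
      ENNReal.ofReal (Real.exp (-(2 * (r ^ (2 * b) - 2 * α * Real.log r)))) := rfl

/-- The moments of the Mittag-Leffler weight are values of the Gamma function. -/
theorem radialMoment_mittagLeffler {α b : ℝ} (hα : -1 < α) (hb : 0 < b) (k : ℕ) :
    radialMoment (complexFactor (mittagLefflerProfile α (b / 2))) (2 * k) =
      ENNReal.ofReal (2 * Real.pi) *
        ENNReal.ofReal (1 / b * Real.Gamma ((2 * α + 2 * k + 1 + 1) / b)) := by
  have hs : -1 < 2 * α + 2 * k + 1 := by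
    have : (0 : ℝ) ≤ k := Nat.cast_nonneg k
    linarith
  have hm : Measurable (complexFactor (mittagLefflerProfile α (b / 2))) :=
    measurable_complexFactor (measurable_mittagLefflerProfile α (b / 2)).coe_real_ereal
  rw [radialMoment_eq_lintegral_Ioi _ hm, ← integral_rpow_mul_exp_neg_rpow hb hs,
    ofReal_integral_eq_lintegral_ofReal (integrableOn_rpow_mul_exp_neg_rpow hs hb)]
  · congr 1
    refine setLIntegral_congr_fun measurableSet_Ioi fun r hr => ?_
    have hr' : (0 : ℝ) < r := hr
    simp only [complexFactor_mittagLeffler]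
    rw [← ENNReal.ofReal_mul (Real.exp_nonneg _)]
    congr 1
    rw [← Real.rpow_natCast r (2 * k + 1), Real.rpow_def_of_pos hr' ((2 * k + 1 : ℕ) : ℝ),
      Real.rpow_def_of_pos hr' (2 * α + 2 * k + 1), ← Real.exp_add, ← Real.exp_add,
      mul_div_cancel₀ _ two_ne_zero]
    congr 1
    push_cast
    ring
  · refine (ae_restrict_mem measurableSet_Ioi).mono fun r hr => ?_
    have hr' : (0 : ℝ) < r := hr
    simp only [Pi.zero_apply]
    positivity

theorem mittagLeffler_matched {α b : ℝ} (hb : 0 < b) (r : ℝ) (hr : 0 < r) :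
    symplecticFactor (mittagLefflerProfile α b) r =
      ENNReal.ofReal (Real.exp (-(2 * α * Real.log (2 ^ (1 / b))))) *
        complexFactor (mittagLefflerProfile α (b / 2)) (2 ^ (1 / b) * r ^ 2) := by
  have hc : (0 : ℝ) < 2 ^ (1 / b) := by positivity
  rw [symplecticFactor_mittagLeffler, complexFactor_mittagLeffler,
    ← ENNReal.ofReal_mul (Real.exp_nonneg _), ← Real.exp_add]
  have hpow : ((2 : ℝ) ^ (1 / b) * r ^ 2) ^ (2 * (b / 2)) = 2 * r ^ (2 * b) := by
    rw [mul_div_cancel₀ _ two_ne_zero, Real.mul_rpow hc.le (by positivity),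
      ← Real.rpow_mul zero_le_two, one_div_mul_cancel hb.ne', Real.rpow_one, ← Real.rpow_natCast r 2, ← Real.rpow_mul hr.le]
    norm_num
  rw [hpow, Real.log_mul hc.ne' (by positivity), Real.log_pow]
  congr 2
  push_cast
  ring

theorem mittagLeffler_ensembles (N : ℕ) {D : Set ℂ} (hDm : MeasurableSet D)
    (hD : IsRadiallySymmetric D) {α b : ℝ} (hα : -1 < α) (hb : 0 < b) :
    IsProbabilityMeasure (symplecticEnsemble N (radialPotential (mittagLefflerProfile α b))) ∧
      IsProbabilityMeasure
        (complexEnsemble N (radialPotential (mittagLefflerProfile α (b / 2)))) ∧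
      gapProbability (symplecticEnsemble N (radialPotential (mittagLefflerProfile α b))) D =
        gapProbability (complexEnsemble N (radialPotential (mittagLefflerProfile α (b / 2))))
          ((fun z : ℂ => ((2 : ℝ) ^ (1 / b)) • z ^ 2) '' D) := by
  have hH : Measurable (symplecticFactor (mittagLefflerProfile α b)) := by
    simp_rw [funext (symplecticFactor_mittagLeffler α b)]
    exact ((measurable_mittagLefflerProfile α b).const_mul 2).neg.exp.ennreal_ofReal
  have hC : Measurable (complexFactor (mittagLefflerProfile α (b / 2))) :=
    measurable_complexFactor (measurable_mittagLefflerProfile α (b / 2)).coe_real_ereal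
  refine symplectic_complex_of_matched N hDm hD hH hC (by positivity)
    (ENNReal.ofReal_pos.2 (Real.exp_pos _)).ne' ENNReal.ofReal_ne_top (mittagLeffler_matched hb)
    ?_ ?_
  · refine Finset.prod_ne_zero_iff.2 fun k _ => ?_
    have hs : 0 < 2 * α + 2 * ((k : ℕ) : ℝ) + 1 + 1 := by
      have : (0 : ℝ) ≤ (k : ℕ) := Nat.cast_nonneg _
      linarith
    have hΓ := Real.Gamma_pos_of_pos (div_pos hs hb)
    rw [radialMoment_mittagLeffler hα hb]
    exact mul_ne_zero (ENNReal.ofReal_pos.2 (by positivity)).ne'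
      (ENNReal.ofReal_pos.2 (by positivity)).ne'
  · refine ENNReal.prod_ne_top fun k _ => ?_
    rw [radialMoment_mittagLeffler hα hb]
    exact ENNReal.mul_ne_top ENNReal.ofReal_ne_top ENNReal.ofReal_ne_top

theorem ginibreProfile_eq_mittagLefflerProfile : ginibreProfile = mittagLefflerProfile 0 1 := by
  ext r
  simp [ginibreProfile, mittagLefflerProfile]

end PlanarEnsembles

theorem mainTheorem4 (N : ℕ) (D : Set ℂ) (hDm : MeasurableSet D)
    (hD : PlanarEnsembles.IsRadiallySymmetric D) :
    -- the relation between the gap probabilities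
    (∀ ωC : ℝ → EReal, Measurable ωC →
      PlanarEnsembles.complexPartition N (PlanarEnsembles.radialPotential ωC) ≠ 0 →
      PlanarEnsembles.complexPartition N (PlanarEnsembles.radialPotential ωC) ≠ ⊤ →
      IsProbabilityMeasure (PlanarEnsembles.symplecticEnsemble N
        (PlanarEnsembles.radialPotential (PlanarEnsembles.symplecticProfile ωC))) ∧
      IsProbabilityMeasure (PlanarEnsembles.complexEnsemble N
        (PlanarEnsembles.radialPotential ωC)) ∧
      PlanarEnsembles.gapProbability (PlanarEnsembles.symplecticEnsemble N
          (PlanarEnsembles.radialPotential (PlanarEnsembles.symplecticProfile ωC))) D =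
        PlanarEnsembles.gapProbability (PlanarEnsembles.complexEnsemble N
          (PlanarEnsembles.radialPotential ωC)) ((fun z : ℂ => z ^ 2) '' D)) ∧
    -- the Mittag-Leffler ensembles
    (∀ α b : ℝ, -1 < α → 0 < b →
      IsProbabilityMeasure (PlanarEnsembles.symplecticEnsemble N
        (PlanarEnsembles.radialPotential (PlanarEnsembles.mittagLefflerProfile α b))) ∧
      IsProbabilityMeasure (PlanarEnsembles.complexEnsemble N
        (PlanarEnsembles.radialPotential (PlanarEnsembles.mittagLefflerProfile α (b / 2)))) ∧
      PlanarEnsembles.gapProbability (PlanarEnsembles.symplecticEnsemble N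
          (PlanarEnsembles.radialPotential (PlanarEnsembles.mittagLefflerProfile α b))) D =
        PlanarEnsembles.gapProbability (PlanarEnsembles.complexEnsemble N
          (PlanarEnsembles.radialPotential (PlanarEnsembles.mittagLefflerProfile α (b / 2))))
          ((fun z : ℂ => ((2 : ℝ) ^ (1 / b)) • z ^ 2) '' D)) ∧
    -- the symplectic Ginibre ensemble
    (IsProbabilityMeasure (PlanarEnsembles.symplecticEnsemble N
        (PlanarEnsembles.radialPotential PlanarEnsembles.ginibreProfile)) ∧
      IsProbabilityMeasure (PlanarEnsembles.complexEnsemble N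
        (PlanarEnsembles.radialPotential (PlanarEnsembles.mittagLefflerProfile 0 (1 / 2)))) ∧
      PlanarEnsembles.gapProbability (PlanarEnsembles.symplecticEnsemble N
          (PlanarEnsembles.radialPotential PlanarEnsembles.ginibreProfile)) D =
        PlanarEnsembles.gapProbability (PlanarEnsembles.complexEnsemble N
          (PlanarEnsembles.radialPotential (PlanarEnsembles.mittagLefflerProfile 0 (1 / 2))))
          ((fun z : ℂ => (2 : ℝ) • z ^ 2) '' D)) := by
  refine ⟨fun ωC hω hZ0 hZ => ?_, fun α b hα hb => ?_, ?_⟩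
  · have hC := PlanarEnsembles.measurable_complexFactor hω
    have hH : Measurable
        (PlanarEnsembles.symplecticFactor (PlanarEnsembles.symplecticProfile ωC)) := by
      rw [funext (PlanarEnsembles.symplecticFactor_symplecticProfile ωC)]
      exact hC.comp (measurable_id.pow_const 2)
    have hfac : (N.factorial : ℝ≥0∞) ≠ 0 := by exact_mod_cast N.factorial_ne_zero
    have hpart := PlanarEnsembles.factorial_mul_complexPartition N hC
    rw [ENNReal.mul_right_inj hfac (ENNReal.natCast_ne_top _)] at hpart
    rw [hpart] at hZ0 hZ
    have h := PlanarEnsembles.symplectic_complex_of_matched N hDm hD hH hC one_pos one_ne_zero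
      ENNReal.one_ne_top (fun r _ => by
        rw [one_mul, one_mul, PlanarEnsembles.symplecticFactor_symplecticProfile]) hZ0 hZ
    simpa only [one_smul] using h
  · exact PlanarEnsembles.mittagLeffler_ensembles N hDm hD hα hb
  · have h := PlanarEnsembles.mittagLeffler_ensembles N hDm hD (α := 0) (b := 1) (by norm_num)
      one_pos
    rw [PlanarEnsembles.ginibreProfile_eq_mittagLefflerProfile]
    simpa only [one_div_one, Real.rpow_one] using h
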